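/- Let $D$ be a compact metric space with metric $d$, let $\lambda$ be a Radon (hence finite) Borel measure on $D$, and let $\mu>0$. Let $\mathbf C=\{\mathtt R,\mathtt B\}$ be the set of colors (red and blue), write $\bar{\mathtt R}=\mathtt B$, $\bar{\mathtt B}=\mathtt R$, and let $\bar\lambda=\lambda\otimes m_{\mathbf C}$ on $D\times\mathbf C$, where $m_{\mathbf C}$ is the counting measure on $\mathbf C$. For $x=(p,c)\in D\times\mathbf C$ put $N(x)=\{q\in D: d(p,q)<1\}\times\{\bar c\}$, and for $A\subseteq D\times\mathbf C$ put $N(A)=\bigcup_{x\in A}N(x)$. For a finite set $\xi\subseteq D\times\mathbf C$ with $n$ elements define $$\tilde\Pi(\xi)=\sum_{(X_1,\dots,X_n)}\ \prod_{i=1}^{n}\frac{1}{\bar\lambda\big(N(\{X_1,\dots,X_i\})\big)+i\mu},$$ where the sum is over all $n!$ orderings $(X_1,\dots,X_n)$ of the elements of $\xi$ (so $\tilde\Pi(\emptyset)=1$). **Theorem.** If $\xi$ and $\gamma$ are finite subsets of $D\times\{\mathtt R\}$, then $$\tilde\Pi(\xi\cup\gamma)\,\tilde\Pi(\xi\cap\gamma)\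 \ge\ \tilde\Pi(\xi)\,\tilde\Pi(\gamma).$$ The same inequality holds if $\xi$ and $\gamma$ are finite subsets of $D\times\{\mathtt B\}$. -/

import Mathlib

open MeasureTheory

noncomputable section

namespace SpatialMatching

/-- The two types of particles. -/
inductive Color where
  | red : Color
  | blue : Color
  deriving DecidableEq

/-- The opposite color. -/
def Color.opp : Color → Color
  | .red => .blue
  | .blue => .red

instance : MeasurableSpace Color := ⊤

/-- The set of all orderings `(X_1, …, X_n)` of a finite set with `n` elements. -/
def orderings {α : Type*} [DecidableEq α] (s : Finset α) : Finset (List α) :=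
  ⟨s.val.lists, Multiset.lists_nodup_finset s⟩

theorem mem_orderings {α : Type*} [DecidableEq α] (s : Finset α) (X : List α) :
    X ∈ orderings s ↔ X.Nodup ∧ ∀ x, x ∈ X ↔ x ∈ s := by
  unfold orderings
  rw [Finset.mem_mk, Multiset.mem_lists_iff]
  constructor
  · intro h
    have h' : s.val = (X : Multiset α) := h
    refine ⟨?_, fun x => ?_⟩
    · rw [← Multiset.coe_nodup, ← h']
      exact s.nodup
    · rw [← Multiset.mem_coe, ← h', Finset.mem_val]
  · rintro ⟨hn, hm⟩
    refine (Multiset.Nodup.ext s.nodup (Multiset.coe_nodup.2 hn)).2 fun x => ?_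
    rw [Multiset.mem_coe, Finset.mem_val]
    exact (hm x).symm

section Defs

variable {D : Type*} [MetricSpace D]

/-- `N(x) = B(p_x, 1) × {opposite color of x}`, with the open unit ball. -/
def nbhd (x : D × Color) : Set (D × Color) :=
  Metric.ball x.1 1 ×ˢ {x.2.opp}

/-- `N(A) = ⋃_{x ∈ A} N(x)`. -/
def nbhdSet (A : Set (D × Color)) : Set (D × Color) :=
  ⋃ x ∈ A, nbhd x

/-- The measure `λ ⊗ (counting measure on colors)` on `D × {red, blue}`. -/
def lamBar [MeasurableSpace D] (lam : Measure D) : Measure (D × Color) :=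
  lam.prod Measure.count

/-- The weight `∏_{i=1}^n 1 / (λ̄(N({X_1, …, X_i})) + i μ)` of an ordered list
`(X_1, …, X_n)`; the index `i` below runs over `0, …, n - 1`. -/
def orderedWeight [MeasurableSpace D] (lam : Measure D) (μ : ℝ)
    (X : List (D × Color)) : ℝ :=
  ∏ i ∈ Finset.range X.length,
    1 / ((lamBar lam).real (nbhdSet {x | x ∈ X.take (i + 1)}) + ((i + 1 : ℕ) : ℝ) * μ)

/-- `Π̃(s)`, the unnormalized Janossy density: the sum of the weights over all
orderings of the finite configuration `s`. -/
def tildePi [MeasurableSpace D] [DecidableEq D] (lam : Measure D) (μ : ℝ)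
    (s : Finset (D × Color)) : ℝ :=
  ∑ X ∈ orderings s, orderedWeight lam μ X

end Defs

end SpatialMatching

end

namespace SpatialMatching

section LogSupermodular

variable {α : Type*} [DecidableEq α]

/-! The last factor of an ordered weight depends only on the whole set `A`. Splitting orderings by
their last particle therefore gives `W A * Φ A = ∑ z ∈ A, Φ (A.erase z)`, with `Φ` the density and
`W` the total rate (`totalRate_mul_tildePi`). The rate is submodular, being the measure of a union
plus a multiple of the cardinality. By induction on `A`, these two facts force the inequality on
elementary squares (`mul_insert_le_of_submodular`); chaining squares gives it for all pairs of sets.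
-/

/-- Chaining two inequalities between products of real numbers. -/
theorem mul_le_mul_of_mul_le_mul_chain {p q r s t v : ℝ} (hq : 0 < q) (hs : 0 ≤ s) (ht : 0 ≤ t)
    (h₁ : p * q ≤ r * s) (h₂ : r * t ≤ v * q) : p * t ≤ v * s := by
  refine le_of_mul_le_mul_right ?_ hq
  calc p * t * q = p * q * t := by ring
    _ ≤ r * s * t := mul_le_mul_of_nonneg_right h₁ ht
    _ = r * t * s := by ring
    _ ≤ v * q * s := mul_le_mul_of_nonneg_right h₂ hs
    _ = v * s * q := by ring

/-- A positive function `Φ` with `W A * Φ A = ∑ z ∈ A, Φ (A \ {z})` for a submodular `W` satisfies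
the log-supermodularity inequality on the squares `A, A ∪ {x}, A ∪ {y}, A ∪ {x, y}`. -/
theorem mul_insert_le_of_submodular {W Φ : Finset α → ℝ}
    (hW : ∀ A B, W (A ∪ B) + W (A ∩ B) ≤ W A + W B) (hΦ : ∀ A, 0 < Φ A)
    (hrec : ∀ A, W A * Φ A = ∑ z ∈ A, Φ (A.erase z))
    (A : Finset α) {x y : α} (hx : x ∉ A) (hy : y ∉ A) (hxy : x ≠ y) :
    Φ (insert x A) * Φ (insert y A) ≤ Φ (insert x (insert y A)) * Φ A := by
  induction A using Finset.strongInduction generalizing x y with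
  | H A ih =>
  have hxS : x ∉ insert y A := by simp [hxy, hx]
  set a := Φ A with ha
  set b := Φ (insert x A) with hb
  set c := Φ (insert y A) with hc
  set d := Φ (insert x (insert y A)) with hd
  have ha0 : 0 < a := hΦ _
  have hb0 : 0 < b := hΦ _
  have hc0 : 0 < c := hΦ _
  have hd0 : 0 < d := hΦ _
  have eb : W (insert x A) * b = a + ∑ z ∈ A, Φ (insert x (A.erase z)) := by
    rw [hrec, Finset.sum_insert hx, Finset.erase_insert hx]
    congr 1
    refine Finset.sum_congr rfl fun z hz => ?_
    rw [Finset.erase_insert_of_ne (show x ≠ z from fun h => hx (h ▸ hz))]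
  have ec : W (insert y A) * c = a + ∑ z ∈ A, Φ (insert y (A.erase z)) := by
    rw [hrec, Finset.sum_insert hy, Finset.erase_insert hy]
    congr 1
    refine Finset.sum_congr rfl fun z hz => ?_
    rw [Finset.erase_insert_of_ne (show y ≠ z from fun h => hy (h ▸ hz))]
  have ed : W (insert x (insert y A)) * d =
      c + (b + ∑ z ∈ A, Φ (insert x (insert y (A.erase z)))) := by
    rw [hrec, Finset.sum_insert hxS, Finset.erase_insert hxS, Finset.sum_insert hy,
      Finset.erase_insert_of_ne hxy, Finset.erase_insert hy]
    congr 2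
    refine Finset.sum_congr rfl fun z hz => ?_
    rw [Finset.erase_insert_of_ne (show x ≠ z from fun h => hx (h ▸ hz)),
      Finset.erase_insert_of_ne (show y ≠ z from fun h => hy (h ▸ hz))]
  -- The inequality holds for each `z`. With `a', b', c', d'` for `a, b, c, d` after erasing `z`
  -- from `A`, induction gives `b' * c' ≤ d' * a'`, `a * b' ≤ b * a'` and `a * c' ≤ c * a'`. Expand
  -- `(b * a' - a * b') * (c * a' - a * c') ≥ 0`, bound `b' * c'`, and cancel `a'`.
  have key : a * c * ∑ z ∈ A, Φ (insert x (A.erase z)) +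
      a * b * ∑ z ∈ A, Φ (insert y (A.erase z)) - b * c * ∑ z ∈ A, Φ (A.erase z) ≤
      a ^ 2 * ∑ z ∈ A, Φ (insert x (insert y (A.erase z))) := by
    simp only [Finset.mul_sum]
    rw [← Finset.sum_add_distrib, ← Finset.sum_sub_distrib]
    refine Finset.sum_le_sum fun z hz => ?_
    have hzx : x ≠ z := fun h => hx (h ▸ hz)
    have hzy : y ≠ z := fun h => hy (h ▸ hz)
    have hxe : x ∉ A.erase z := fun h => hx (Finset.mem_of_mem_erase h)
    have hye : y ∉ A.erase z := fun h => hy (Finset.mem_of_mem_erase h)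
    have h₁ := ih _ (Finset.erase_ssubset hz) hxe hye hxy
    have h₂ := ih _ (Finset.erase_ssubset hz) hxe (Finset.notMem_erase z A) hzx
    have h₃ := ih _ (Finset.erase_ssubset hz) hye (Finset.notMem_erase z A) hzy
    rw [Finset.insert_erase hz, ← ha, ← hb] at h₂
    rw [Finset.insert_erase hz, ← ha, ← hc] at h₃
    refine le_of_mul_le_mul_right ?_ (hΦ (A.erase z))
    linarith [mul_nonneg (sub_nonneg.2 h₂) (sub_nonneg.2 h₃),
      mul_le_mul_of_nonneg_left h₁ (sq_nonneg a)]
  have hsub : W (insert x (insert y A)) + W A ≤ W (insert x A) + W (insert y A) := by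
    have h := hW (insert x A) (insert y A)
    have hu : insert x A ∪ insert y A = insert x (insert y A) := by
      ext z; simp only [Finset.mem_union, Finset.mem_insert]; tauto
    have hi : insert x A ∩ insert y A = A := by
      rw [Finset.insert_inter_of_notMem hxS, Finset.inter_eq_left.2 (Finset.subset_insert y A)]
    rwa [hu, hi] at h
  -- Positivity of `W` is not assumed; it comes from the recursion.
  have hpos : 0 < W (insert x (insert y A)) := by
    refine pos_of_mul_pos_left (b := d) ?_ hd0.le
    rw [ed]
    have : 0 ≤ ∑ z ∈ A, Φ (insert x (insert y (A.erase z))) :=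
      Finset.sum_nonneg fun z _ => (hΦ _).le
    linarith
  rw [← hrec A, ← ha] at key
  rw [← sub_eq_iff_eq_add'] at eb ec ed
  rw [← sub_eq_iff_eq_add'] at ed
  rw [← eb, ← ec, ← ed] at key
  -- In `key` the terms `a ^ 2 * (b + c)` cancel, leaving `b * c` times `W (A ∪ {x}) + W (A ∪ {y}) -
  -- W A`, which submodularity bounds below.
  refine le_of_mul_le_mul_right ?_ (mul_pos ha0 hpos)
  linarith [mul_le_mul_of_nonneg_left hsub (mul_pos (mul_pos ha0 hb0) hc0).le]

/-- A positive function with increasing ratios `Φ (A ∪ {x}) / Φ A` is log-supermodular. -/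
theorem mul_le_union_mul_inter_of_insert {Φ : Finset α → ℝ} (hΦ : ∀ A, 0 < Φ A)
    (h : ∀ (A : Finset α) (x y : α), x ∉ A → y ∉ A → x ≠ y →
      Φ (insert x A) * Φ (insert y A) ≤ Φ (insert x (insert y A)) * Φ A)
    (A B : Finset α) : Φ A * Φ B ≤ Φ (A ∪ B) * Φ (A ∩ B) := by
  -- The ratio for adding `x` grows as the base set grows from `A` to `T ∪ A`.
  have one : ∀ (x : α) (A T : Finset α), x ∉ T ∪ A →
      Φ (insert x A) * Φ (T ∪ A) ≤ Φ (insert x (T ∪ A)) * Φ A := by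
    intro x A T
    induction T using Finset.induction_on with
    | empty => intro _; simp
    | insert t T _ ih =>
      intro hx
      rw [Finset.insert_union] at hx ⊢
      have hxt : x ≠ t := fun e => hx (e ▸ Finset.mem_insert_self _ _)
      have hxT : x ∉ T ∪ A := fun e => hx (Finset.mem_insert_of_mem e)
      by_cases ht : t ∈ T ∪ A
      · rw [Finset.insert_eq_of_mem ht]
        exact ih hxT
      · exact mul_le_mul_of_mul_le_mul_chain (hΦ _) (hΦ _).le (hΦ _).le (ih hxT)
          (h _ x t hxT ht hxt)
  have many : ∀ (A T C : Finset α), Disjoint C (T ∪ A) →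
      Φ (C ∪ A) * Φ (T ∪ A) ≤ Φ (C ∪ (T ∪ A)) * Φ A := by
    intro A T C
    induction C using Finset.induction_on with
    | empty => intro _; simp [mul_comm]
    | insert t C htC ih =>
      intro hd
      rw [Finset.disjoint_insert_left] at hd
      have htn : t ∉ T ∪ (C ∪ A) := by
        rw [Finset.union_left_comm, Finset.mem_union]
        exact fun e => e.elim htC hd.1
      have h₁ := ih hd.2
      have h₂ := one t (C ∪ A) T htn
      rw [Finset.union_left_comm] at h₂
      rw [Finset.insert_union, Finset.insert_union, mul_comm (Φ (insert t (C ∪ A)))]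
      rw [mul_comm] at h₁
      exact mul_le_mul_of_mul_le_mul_chain (hΦ _) (hΦ _).le (hΦ _).le h₁ (by rwa [mul_comm])
  have hm := many (A ∩ B) (A \ B) (B \ A) (by
    rw [Finset.sdiff_union_inter]
    exact Finset.sdiff_disjoint)
  rw [Finset.sdiff_union_inter, Finset.inter_comm, Finset.sdiff_union_inter,
    Finset.sdiff_union_self_eq_union, Finset.union_comm B A, Finset.inter_comm] at hm
  rwa [mul_comm (Φ A)]

end LogSupermodular

section Orderings

variable {α : Type*} [DecidableEq α]

/-- Sorts orderings by their last element, the one whose removal leaves all earlier factors of the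
weight unchanged. -/
theorem sum_orderings_eq_sum_append {M : Type*} [AddCommMonoid M] {s : Finset α}
    (hs : s.Nonempty) (f : List α → M) :
    ∑ X ∈ orderings s, f X = ∑ z ∈ s, ∑ Y ∈ orderings (s.erase z), f (Y ++ [z]) := by
  have hne : ∀ X ∈ orderings s, X ≠ [] := by
    rintro X hX rfl
    obtain ⟨z, hz⟩ := hs
    exact List.not_mem_nil ((((mem_orderings _ _).1 hX).2 z).2 hz)
  rw [Finset.sum_sigma']
  symm
  refine Finset.sum_bij (fun (p : (_ : α) × List α) _ => p.2 ++ [p.1]) ?_ ?_ ?_ fun _ _ => rfl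
  · rintro ⟨z, Y⟩ hp
    rw [Finset.mem_sigma, mem_orderings] at hp
    obtain ⟨hz, hnd, hm⟩ := hp
    dsimp only at hz hnd hm ⊢
    rw [mem_orderings]
    refine ⟨List.nodup_append.2 ⟨hnd, List.nodup_singleton z, ?_⟩, fun w => ?_⟩
    · intro u hu v hv
      rw [List.mem_singleton.1 hv]
      exact Finset.ne_of_mem_erase ((hm u).1 hu)
    · rw [List.mem_append, hm, List.mem_singleton, Finset.mem_erase]
      refine ⟨fun h => h.elim (fun h => h.2) (fun h => h ▸ hz), fun h => ?_⟩
      by_cases e : w = z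
      · exact Or.inr e
      · exact Or.inl ⟨e, h⟩
  · rintro ⟨z, Y⟩ _ ⟨z', Y'⟩ _ h
    obtain ⟨h₁, h₂⟩ := List.append_inj' h rfl
    cases h₁
    cases h₂
    rfl
  · intro X hX
    have hX0 := hne X hX
    have happ := List.dropLast_append_getLast hX0
    obtain ⟨hnd, hm⟩ := (mem_orderings _ _).1 hX
    rw [← happ] at hnd
    obtain ⟨hnd₁, -, hdis⟩ := List.nodup_append.1 hnd
    refine ⟨⟨X.getLast hX0, X.dropLast⟩, ?_, happ⟩
    rw [Finset.mem_sigma, mem_orderings]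
    refine ⟨(hm _).1 (List.getLast_mem hX0), hnd₁, fun w => ?_⟩
    rw [Finset.mem_erase, ← hm w]
    refine ⟨fun h => ⟨hdis w h _ (List.mem_singleton_self _), List.mem_of_mem_dropLast h⟩, ?_⟩
    rintro ⟨h, hw⟩
    rw [← happ, List.mem_append, List.mem_singleton] at hw
    exact hw.resolve_right h

theorem orderings_nonempty (s : Finset α) : (orderings s).Nonempty :=
  ⟨s.toList, (mem_orderings _ _).2 ⟨s.nodup_toList, fun _ => Finset.mem_toList⟩⟩

theorem length_of_mem_orderings {s : Finset α} {X : List α} (hX : X ∈ orderings s) :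
    X.length = s.card := by
  obtain ⟨hnd, hm⟩ := (mem_orderings _ _).1 hX
  rw [← List.toFinset_card_of_nodup hnd]
  congr 1
  ext x
  rw [List.mem_toFinset, hm]

end Orderings

section Matching

variable {D : Type*} [MetricSpace D]

theorem nbhdSet_union (A B : Set (D × Color)) :
    nbhdSet (A ∪ B) = nbhdSet A ∪ nbhdSet B :=
  Set.biUnion_union A B _

theorem nbhdSet_inter_subset (A B : Set (D × Color)) :
    nbhdSet (A ∩ B) ⊆ nbhdSet A ∩ nbhdSet B :=
  Set.subset_inter (Set.biUnion_subset_biUnion_left Set.inter_subset_left)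
    (Set.biUnion_subset_biUnion_left Set.inter_subset_right)

variable [MeasurableSpace D]

theorem measurableSet_nbhdSet [OpensMeasurableSpace D] (A : Finset (D × Color)) :
    MeasurableSet (nbhdSet (A : Set (D × Color))) :=
  Finset.measurableSet_biUnion A fun _ _ =>
    Metric.isOpen_ball.measurableSet.prod MeasurableSpace.measurableSet_top

instance isFiniteMeasure_lamBar (lam : Measure D) [IsFiniteMeasure lam] :
    IsFiniteMeasure (lamBar lam) := by
  have : Finite Color := Finite.of_surjective (fun b : Bool => if b then Color.red else Color.blue)
    (by rintro (_ | _); exacts [⟨true, rfl⟩, ⟨false, rfl⟩])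
  unfold lamBar
  infer_instance

/-- The total rate `λ̄(N(A)) + |A| μ` of the configuration `A`. -/
noncomputable def totalRate (lam : Measure D) (μ : ℝ) (A : Finset (D × Color)) : ℝ :=
  (lamBar lam).real (nbhdSet (A : Set (D × Color))) + (A.card : ℝ) * μ

theorem totalRate_empty (lam : Measure D) (μ : ℝ) : totalRate lam μ ∅ = 0 := by
  simp [totalRate, nbhdSet]

theorem totalRate_pos (lam : Measure D) {μ : ℝ} (hμ : 0 < μ) {A : Finset (D × Color)}
    (hA : A.Nonempty) : 0 < totalRate lam μ A :=
  add_pos_of_nonneg_of_pos measureReal_nonneg (mul_pos (Nat.cast_pos.2 hA.card_pos) hμ)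

/-- `N` commutes with unions but only satisfies `N(A ∩ B) ⊆ N(A) ∩ N(B)`, whence the inequality; the
cardinality term contributes equality. -/
theorem totalRate_submodular [OpensMeasurableSpace D] [DecidableEq D] (lam : Measure D)
    [IsFiniteMeasure lam] (μ : ℝ) (A B : Finset (D × Color)) :
    totalRate lam μ (A ∪ B) + totalRate lam μ (A ∩ B) ≤ totalRate lam μ A + totalRate lam μ B := by
  have h₁ := measureReal_union_add_inter (μ := lamBar lam)
    (s := nbhdSet (A : Set (D × Color))) (measurableSet_nbhdSet B)
  have h₂ := measureReal_mono (μ := lamBar lam)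
    (nbhdSet_inter_subset (A : Set (D × Color)) (B : Set (D × Color)))
  have h₃ : ((A ∪ B).card : ℝ) + ((A ∩ B).card : ℝ) = A.card + B.card := by
    exact_mod_cast Finset.card_union_add_card_inter A B
  have h₄ := congrArg (· * μ) h₃
  simp only [add_mul] at h₄
  unfold totalRate
  rw [Finset.coe_union, Finset.coe_inter, nbhdSet_union]
  linarith

theorem orderedWeight_append_singleton (lam : Measure D) (μ : ℝ) (Y : List (D × Color))
    (z : D × Color) :
    orderedWeight lam μ (Y ++ [z]) = orderedWeight lam μ Y *
      (1 / ((lamBar lam).real (nbhdSet {x | x ∈ Y ++ [z]}) + ((Y.length + 1 : ℕ) : ℝ) * μ)) := by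
  have hlen : (Y ++ [z]).length = Y.length + 1 := by simp
  unfold orderedWeight
  rw [hlen, Finset.prod_range_succ, List.take_of_length_le hlen.le]
  congr 1
  refine Finset.prod_congr rfl fun i hi => ?_
  rw [List.take_append_of_le_length (Finset.mem_range.1 hi)]

theorem orderedWeight_pos (lam : Measure D) {μ : ℝ} (hμ : 0 < μ) (X : List (D × Color)) :
    0 < orderedWeight lam μ X :=
  Finset.prod_pos fun i _ => one_div_pos.2 <|
    add_pos_of_nonneg_of_pos measureReal_nonneg (mul_pos (Nat.cast_pos.2 i.succ_pos) hμ)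

variable [DecidableEq D]

theorem tildePi_pos (lam : Measure D) {μ : ℝ} (hμ : 0 < μ) (s : Finset (D × Color)) :
    0 < tildePi lam μ s :=
  Finset.sum_pos (fun X _ => orderedWeight_pos lam hμ X) (orderings_nonempty s)

/-- The recursion for `Π̃` obtained by removing the last particle of an ordering. -/
theorem totalRate_mul_tildePi (lam : Measure D) {μ : ℝ} (hμ : 0 < μ) (s : Finset (D × Color)) :
    totalRate lam μ s * tildePi lam μ s = ∑ z ∈ s, tildePi lam μ (s.erase z) := by
  rcases s.eq_empty_or_nonempty with rfl | hs
  · rw [totalRate_empty, zero_mul, Finset.sum_empty]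
  · have hpos := totalRate_pos lam hμ hs
    unfold tildePi
    rw [sum_orderings_eq_sum_append hs, Finset.mul_sum]
    refine Finset.sum_congr rfl fun z hz => ?_
    rw [Finset.mul_sum]
    refine Finset.sum_congr rfl fun Y hY => ?_
    have hset : {x | x ∈ Y ++ [z]} = (s : Set (D × Color)) := by
      ext w
      rw [Set.mem_ofPred_eq, List.mem_append, ((mem_orderings _ _).1 hY).2 w, List.mem_singleton,
        Finset.mem_coe, ← Finset.mem_insert.trans or_comm, Finset.insert_erase hz]
    have hcard : Y.length + 1 = s.card := by
      rw [length_of_mem_orderings hY, Finset.card_erase_add_one hz]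
    rw [orderedWeight_append_singleton, hset, hcard, ← totalRate]
    field_simp

end Matching

end SpatialMatching

theorem mainTheorem4 {D : Type*} [MetricSpace D] [CompactSpace D] [MeasurableSpace D]
    [BorelSpace D] [DecidableEq D] (lam : MeasureTheory.Measure D)
    [MeasureTheory.IsFiniteMeasureOnCompacts lam] (μ : ℝ) (hμ : 0 < μ)
    (c : SpatialMatching.Color) (ξ γ : Finset (D × SpatialMatching.Color))
    (hξ : ∀ x ∈ ξ, x.2 = c) (hγ : ∀ x ∈ γ, x.2 = c) :
    SpatialMatching.tildePi lam μ ξ * SpatialMatching.tildePi lam μ γ ≤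
      SpatialMatching.tildePi lam μ (ξ ∪ γ) * SpatialMatching.tildePi lam μ (ξ ∩ γ) :=
  SpatialMatching.mul_le_union_mul_inter_of_insert (SpatialMatching.tildePi_pos lam hμ)
    (fun A _ _ hx hy hxy => SpatialMatching.mul_insert_le_of_submodular
      (SpatialMatching.totalRate_submodular lam μ) (SpatialMatching.tildePi_pos lam hμ)
      (SpatialMatching.totalRate_mul_tildePi lam hμ) A hx hy hxy) ξ γ
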